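/- **Lemma 4.4.** Let $\Gamma\subseteq\mathbb R^d$ be an open semi-algebraic set (a finite union of sets of the form $\{x : f(x)=0\ \forall f\in F,\ h(x)>0\ \forall h\in H\}$ with $F,H$ collections of real polynomials, $H$ finite), let $\mathbf f:\Gamma\to\mathbb R^k$ be a polynomial map or a rational map defined everywhere on $\Gamma$ (each coordinate is a quotient of two polynomials whose denominator has no zero on $\Gamma$), and let $\Theta_0=\mathbf f(\Gamma)$. Let $\gamma_0\in\Gamma$ and $\theta_0=\mathbf f(\gamma_0)$. If $\theta_0$ is a nonsingular point of $\Theta_0$ and the $k\times d$ Jacobian matrix of $\mathbf f$ at $\gamma_0$ has full rank $\min(k,d)$, then $\theta_0\in\operatorname{int}(\Theta_0)$. Here the Zariski closure $\bar\Theta_0$ is the set of common zeros in $\mathbb R^k$ of all real polynomials vanishing on $\Theta_0$, and $\operatorname{int}(\Theta_0)$ is the union of all subsets of $\Theta_0$ of the form $O\cap\bar\Theta_0$ with $O\subseteq\mathbb R^k$ open. A real algebraic variety $V\subseteq\mathbb R^k$ (the set of common zeros of a collection of real polynomials) is irreducible if it is not the union of two strict subsets that are real algebraic varieties; its irreducible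 components are the maximal irreducible varieties contained in it. For an irreducible variety $V$ whose ideal $\mathcal I(V)$ of polynomials vanishing on $V$ is generated by $g_1,\dots,g_\ell$, a point $\theta\in V$ is singular if the rank of the matrix $(\partial g_i/\partial t_j(\theta))_{i,j}$ is smaller than the maximal rank of $(\partial g_i/\partial t_j(\theta'))_{i,j}$ over $\theta'\in V$ (this does not depend on the generators). A point of a general variety is singular if it is a singular point of one of the irreducible components or lies in two different components. A point of $\Theta_0$ is singular if it is a singular point of $\bar\Theta_0$, and nonsingular otherwise. -/

import Mathlib

noncomputable section

namespace RealAlg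

/-! Points of `ℝⁿ` are functions `Fin n → ℝ`; only the topology of `ℝⁿ`, which does not depend on
the norm, enters below. -/

/-- A basic semi-algebraic set: the common zeros of an arbitrary collection `F` of polynomials at
which, in addition, the finitely many polynomials in `H` are all positive. -/
def IsBasicSemialgebraic {n : ℕ} (S : Set (Fin n → ℝ)) : Prop :=
  ∃ (F : Set (MvPolynomial (Fin n) ℝ)) (H : Finset (MvPolynomial (Fin n) ℝ)),
    S = {x | (∀ f ∈ F, MvPolynomial.eval x f = 0) ∧ ∀ h ∈ H, 0 < MvPolynomial.eval x h}

/-- A semi-algebraic set: a finite union of basic semi-algebraic sets. -/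
def IsSemialgebraic {n : ℕ} (S : Set (Fin n → ℝ)) : Prop :=
  ∃ 𝒮 : Set (Set (Fin n → ℝ)), 𝒮.Finite ∧ (∀ B ∈ 𝒮, IsBasicSemialgebraic B) ∧ S = ⋃₀ 𝒮

/-- A real algebraic variety in `ℝⁿ`: the common zeros of a collection of polynomials. -/
def IsVariety {n : ℕ} (V : Set (Fin n → ℝ)) : Prop :=
  ∃ F : Set (MvPolynomial (Fin n) ℝ), V = {x | ∀ f ∈ F, MvPolynomial.eval x f = 0}

/-- The Zariski closure of `Θ`: the common zeros of the ideal of all polynomials that vanish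
on `Θ`. -/
def zariskiClosure {n : ℕ} (Θ : Set (Fin n → ℝ)) : Set (Fin n → ℝ) :=
  MvPolynomial.zeroLocus ℝ (MvPolynomial.vanishingIdeal ℝ Θ)

/-- The interior of `Θ` relative to its Zariski closure: the union of all subsets of `Θ` that are
the intersection of an open subset of `ℝⁿ` with the Zariski closure of `Θ`. -/
def relInterior {n : ℕ} (Θ : Set (Fin n → ℝ)) : Set (Fin n → ℝ) :=
  ⋃₀ {U | U ⊆ Θ ∧ ∃ O : Set (Fin n → ℝ), IsOpen O ∧ U = O ∩ zariskiClosure Θ}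

/-- A variety is irreducible if it is not the union of two strict subsets that are varieties. -/
def IsIrreducibleVariety {n : ℕ} (V : Set (Fin n → ℝ)) : Prop :=
  IsVariety V ∧ ¬ ∃ A B : Set (Fin n → ℝ),
    IsVariety A ∧ IsVariety B ∧ A ⊂ V ∧ B ⊂ V ∧ V = A ∪ B

/-- The irreducible components of `V`: the maximal irreducible varieties contained in `V`. -/
def IsComponent {n : ℕ} (V C : Set (Fin n → ℝ)) : Prop :=
  Maximal (fun W => IsIrreducibleVariety W ∧ W ⊆ V) C

/-- The Jacobian matrix `∂gᵢ/∂tⱼ (θ)` of a finite family of polynomials. -/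
def polyJacobian {n l : ℕ} (g : Fin l → MvPolynomial (Fin n) ℝ) (θ : Fin n → ℝ) :
    Matrix (Fin l) (Fin n) ℝ :=
  Matrix.of fun i j => MvPolynomial.eval θ (MvPolynomial.pderiv j (g i))

/-- `θ` is a singular point of the irreducible variety `V`: for a finite generating family `g` of
the vanishing ideal of `V`, the rank of the Jacobian matrix of `g` at `θ` is smaller than the
maximum of its ranks at the points of `V`, that is, smaller than the rank at some point of `V`.
Ranks at points of `V` do not depend on the choice of `g`, and some `g` exists by Hilbert's basis
theorem. -/
def IsSingularOfIrreducible {n : ℕ} (V : Set (Fin n → ℝ)) (θ : Fin n → ℝ) : Prop :=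
  θ ∈ V ∧ ∃ (l : ℕ) (g : Fin l → MvPolynomial (Fin n) ℝ),
    Ideal.span (Set.range g) = MvPolynomial.vanishingIdeal ℝ V ∧
    ∃ θ' ∈ V, (polyJacobian g θ).rank < (polyJacobian g θ').rank

/-- `θ` is a singular point of the variety `V`: it is a singular point of an irreducible component
or it lies on two different irreducible components. (If `V` is irreducible, then `V` is its only
component and this is `IsSingularOfIrreducible V θ`.) -/
def IsSingularOfVariety {n : ℕ} (V : Set (Fin n → ℝ)) (θ : Fin n → ℝ) : Prop :=
  (∃ C, IsComponent V C ∧ IsSingularOfIrreducible C θ) ∨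
    ∃ C C', IsComponent V C ∧ IsComponent V C' ∧ C ≠ C' ∧ θ ∈ C ∩ C'

/-- `θ` is a singular point of the set `Θ`: it belongs to `Θ` and is a singular point of the
Zariski closure of `Θ`. -/
def IsSingularPoint {n : ℕ} (Θ : Set (Fin n → ℝ)) (θ : Fin n → ℝ) : Prop :=
  θ ∈ Θ ∧ IsSingularOfVariety (zariskiClosure Θ) θ

/-- On `Γ`, the map `f` is a rational map defined everywhere: its coordinates are quotients of
polynomials whose denominators have no zero on `Γ`. Polynomial maps are the case `q = 1`. Nothing
is said about `f` outside `Γ`. -/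
def IsRationalMapOn {d k : ℕ} (f : (Fin d → ℝ) → (Fin k → ℝ)) (Γ : Set (Fin d → ℝ)) : Prop :=
  ∃ p q : Fin k → MvPolynomial (Fin d) ℝ, ∀ γ ∈ Γ, ∀ i,
    MvPolynomial.eval γ (q i) ≠ 0 ∧
    f γ i = MvPolynomial.eval γ (p i) / MvPolynomial.eval γ (q i)

/-- The `k × d` Jacobian matrix of the map `f` at `γ`. -/
def jacobian {d k : ℕ} (f : (Fin d → ℝ) → (Fin k → ℝ)) (γ : Fin d → ℝ) :
    Matrix (Fin k) (Fin d) ℝ :=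
  LinearMap.toMatrix' (fderiv ℝ f γ : (Fin d → ℝ) →ₗ[ℝ] (Fin k → ℝ))

end RealAlg

end

/-!
The rational functions defined everywhere on `Γ` form a domain of transcendence degree `d`. Hence
the ideal of `Θ₀` is prime, and by the Jacobian criterion in characteristic zero the Zariski
tangent space of `Θ₀` has dimension at most `d` at some point of `Θ₀`, so also at the nonsingular
point `θ₀`. By the chain rule it contains the range of the derivative of `f` at `γ₀`, whose
dimension is `min k d`; so the two spaces are equal, and the inverse function theorem shows that
the image of `f` contains all common zeros near `θ₀` of the polynomials that vanish on `Θ₀`.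
-/

open Filter Topology MvPolynomial

namespace RealAlg

section PartialDerivatives

variable {σ R A : Type*}

theorem add_single_mem_support_of_mem_support_pderiv [CommSemiring R] {p : MvPolynomial σ R}
    {j : σ} {m : σ →₀ ℕ} (hm : m ∈ (pderiv j p).support) :
    m + Finsupp.single j 1 ∈ p.support := by
  rw [mem_support_iff, coeff_pderiv] at hm
  exact mem_support_iff.2 (left_ne_zero_of_mul hm)

theorem pderiv_mem_supported [CommSemiring R] {s : Set σ} {p : MvPolynomial σ R}
    (hp : p ∈ supported R s) (j : σ) : pderiv j p ∈ supported R s := by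
  rw [mem_supported] at hp ⊢
  intro i hi
  obtain ⟨m, hm, him⟩ := (mem_vars_iff_mem_support i).1 hi
  refine hp ((mem_vars_iff_mem_support i).2
    ⟨_, add_single_mem_support_of_mem_support_pderiv hm, ?_⟩)
  simp only [Finsupp.mem_support_iff, Finsupp.add_apply] at him ⊢
  omega

theorem totalDegree_pderiv_lt [CommSemiring R] {p : MvPolynomial σ R} {j : σ}
    (h : pderiv j p ≠ 0) : (pderiv j p).totalDegree < p.totalDegree := by
  obtain ⟨m, hm, hdeg⟩ := Finset.exists_mem_eq_sup _ (support_nonempty.2 h)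
    (fun m : σ →₀ ℕ => m.sum fun _ e => e)
  have hle := le_totalDegree (add_single_mem_support_of_mem_support_pderiv hm)
  rw [Finsupp.sum_add_index' (fun _ => rfl) (fun _ _ _ => rfl),
    Finsupp.sum_single_index rfl] at hle
  rw [totalDegree, hdeg]
  omega

theorem notMem_vars_of_pderiv_eq_zero [CommSemiring R] [NoZeroDivisors R] [CharZero R]
    {p : MvPolynomial σ R} {j : σ} (h : pderiv j p = 0) : j ∉ p.vars := by
  intro hj
  obtain ⟨m, hm, hjm⟩ := (mem_vars_iff_mem_support j).1 hj
  have hle : Finsupp.single j 1 ≤ m :=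
    Finsupp.single_le_iff.2 (Nat.one_le_iff_ne_zero.2 (Finsupp.mem_support_iff.1 hjm))
  have hcoeff := coeff_pderiv p (m - Finsupp.single j 1) (i := j)
  rw [h, coeff_zero, tsub_add_cancel_of_le hle] at hcoeff
  exact (mul_ne_zero (mem_support_iff.1 hm) (Nat.cast_add_one_ne_zero _)) hcoeff.symm

theorem algebraicIndepOn_insert_of_aeval_pderiv_eq_zero [CommRing R] [NoZeroDivisors R]
    [CharZero R] [CommRing A] [Algebra R A] {x : σ → A} {s : Set σ} {j : σ}
    (hs : AlgebraicIndepOn R x s)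
    (h : ∀ p ∈ supported R (insert j s), aeval x p = 0 → aeval x (pderiv j p) = 0) :
    AlgebraicIndepOn R x (insert j s) := by
  refine algebraicIndependent_comp_subtype.2 fun p => ?_
  induction hn : p.totalDegree using Nat.strong_induction_on generalizing p with
  | _ n ih =>
    intro hp hxp
    -- A nonzero `∂p/∂xⱼ` would be a relation of smaller degree.
    have hpderiv : pderiv j p = 0 := by
      by_contra hne
      exact hne (ih _ (hn ▸ totalDegree_pderiv_lt hne) _ rfl (pderiv_mem_supported hp j)
        (h p hp hxp))
    refine algebraicIndependent_comp_subtype.1 hs p (mem_supported.2 fun i hi => ?_) hxp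
    exact (mem_supported.1 hp hi).resolve_left fun hij =>
      notMem_vars_of_pderiv_eq_zero hpderiv (hij ▸ hi)

theorem exists_algebraicIndepOn_aeval_pderiv_ne_zero [Finite σ] [Field R] [CharZero R] [CommRing A]
    [Nontrivial A] [Algebra R A] (x : σ → A) :
    ∃ s : Set σ, AlgebraicIndepOn R x s ∧ ∀ j ∉ s, ∃ p ∈ supported R (insert j s),
      aeval x p = 0 ∧ aeval x (pderiv j p) ≠ 0 := by
  have hempty : AlgebraicIndepOn R x ∅ :=
    algebraicIndependent_empty_type_iff.2 (algebraMap R A).injective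
  obtain ⟨s, hs⟩ := (Set.toFinite {s | AlgebraicIndepOn R x s}).exists_maximal ⟨∅, hempty⟩
  refine ⟨s, hs.prop, fun j hj => ?_⟩
  by_contra! hcon
  have hinsert := algebraicIndepOn_insert_of_aeval_pderiv_eq_zero hs.prop hcon
  exact hj (hs.le_of_ge hinsert (Set.subset_insert j s) (Set.mem_insert j s))

end PartialDerivatives

section TangentSpace

/-- The gradient of the polynomial `p` at the point `a`; the rows of `polyJacobian` are
gradients. -/
noncomputable def polyGradient {σ R : Type*} [CommSemiring R] (p : MvPolynomial σ R)
    (a : σ → R) : σ → R :=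
  fun j => eval a (pderiv j p)

variable {σ R : Type*} [CommRing R]

theorem polyGradient_add (p q : MvPolynomial σ R) (a : σ → R) :
    polyGradient (p + q) a = polyGradient p a + polyGradient q a := by
  ext j
  simp [polyGradient]

theorem polyGradient_mul (p q : MvPolynomial σ R) (a : σ → R) :
    polyGradient (p * q) a = eval a p • polyGradient q a + eval a q • polyGradient p a := by
  ext j
  simp [polyGradient]

variable [Fintype σ]

/-- The Zariski tangent space at `a` of the scheme defined by the ideal `I`, as a subspace of the
ambient affine space. It has its geometric meaning only where all of `I` vanishes at `a`. -/
def tangentSpace (I : Ideal (MvPolynomial σ R)) (a : σ → R) : Submodule R (σ → R) where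
  carrier := {v | ∀ p ∈ I, polyGradient p a ⬝ᵥ v = 0}
  zero_mem' _ _ := dotProduct_zero _
  add_mem' hv hw p hp := by rw [dotProduct_add, hv p hp, hw p hp, add_zero]
  smul_mem' c v hv p hp := by rw [dotProduct_smul, hv p hp, smul_zero]

theorem mem_tangentSpace_span {S : Set (MvPolynomial σ R)} {a v : σ → R}
    (ha : ∀ p ∈ S, eval a p = 0) :
    v ∈ tangentSpace (Ideal.span S) a ↔ ∀ p ∈ S, polyGradient p a ⬝ᵥ v = 0 := by
  refine ⟨fun hv p hp => hv p (Ideal.subset_span hp), fun hv p hp => ?_⟩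
  suffices h : eval a p = 0 ∧ polyGradient p a ⬝ᵥ v = 0 from h.2
  induction hp using Submodule.span_induction with
  | mem p hp => exact ⟨ha p hp, hv p hp⟩
  | zero => simp [polyGradient, dotProduct]
  | add p q _ _ hp hq =>
    simp only [map_add, polyGradient_add, add_dotProduct, hp.1, hp.2, hq.1, hq.2, add_zero,
      and_self]
  | smul c p _ hp =>
    simp only [smul_eq_mul, map_mul, polyGradient_mul, smul_dotProduct, hp.1, hp.2, mul_zero,
      zero_smul, add_zero, and_self]

theorem tangentSpace_span_range {n l : ℕ} {g : Fin l → MvPolynomial (Fin n) ℝ} {a : Fin n → ℝ}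
    (ha : ∀ i, eval a (g i) = 0) :
    tangentSpace (Ideal.span (Set.range g)) a = (polyJacobian g a).mulVecLin.ker := by
  ext v
  rw [mem_tangentSpace_span (Set.forall_mem_range.2 ha), Set.forall_mem_range, LinearMap.mem_ker,
    funext_iff]
  rfl

theorem rank_polyJacobian_add_finrank_tangentSpace {n l : ℕ}
    {g : Fin l → MvPolynomial (Fin n) ℝ} {a : Fin n → ℝ} (ha : ∀ i, eval a (g i) = 0) :
    (polyJacobian g a).rank + Module.finrank ℝ (tangentSpace (Ideal.span (Set.range g)) a) = n := by
  rw [tangentSpace_span_range ha, Matrix.rank, LinearMap.finrank_range_add_finrank_ker,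
    Module.finrank_fin_fun]

theorem finrank_tangentSpace_le_card {F : Type*} [Field F] {I : Ideal (MvPolynomial σ F)}
    {a : σ → F} {s : Set σ} {p : σ → MvPolynomial σ F} (hI : ∀ j ∉ s, p j ∈ I)
    (hsupp : ∀ j ∉ s, p j ∈ supported F (insert j s))
    (hne : ∀ j ∉ s, eval a (pderiv j (p j)) ≠ 0) :
    Module.finrank F (tangentSpace I a) ≤ Nat.card s := by
  classical
  let restrict : tangentSpace I a →ₗ[F] (s → F) :=
    (LinearMap.funLeft F F ((↑) : s → σ)).comp (tangentSpace I a).subtype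
  -- For `j ∉ s`, the equation of `p j` determines `v j` from the coordinates of `v` in `s`.
  have hinj : Function.Injective restrict := by
    rw [injective_iff_map_eq_zero]
    rintro ⟨v, hv⟩ hvs
    have hs : ∀ i ∈ s, v i = 0 := fun i hi => congrFun hvs ⟨i, hi⟩
    ext j
    by_cases hj : j ∈ s
    · exact hs j hj
    have hsum : polyGradient (p j) a ⬝ᵥ v = eval a (pderiv j (p j)) * v j := by
      refine Finset.sum_eq_single j (fun i _ hij => ?_) (by simp)
      by_cases hi : i ∈ s
      · rw [hs i hi, mul_zero]
      · have hvars : i ∉ (p j).vars := fun h => (mem_supported.1 (hsupp j hj) h).elim hij hi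
        rw [polyGradient, pderiv_eq_zero_of_notMem_vars hvars, map_zero, zero_mul]
    exact (mul_eq_zero.1 (hsum.symm.trans (hv _ (hI j hj)))).resolve_left (hne j hj)
  have hle := LinearMap.finrank_le_finrank_of_injective hinj
  rwa [Module.finrank_pi, ← Nat.card_eq_fintype_card] at hle

theorem exists_finrank_tangentSpace_le_trdeg {F : Type*} {A : Type*} [Field F]
    [CharZero F] [CommRing A] [IsDomain A] [Algebra F A] {Θ : Set (σ → F)}
    (φ : MvPolynomial σ F →ₐ[F] A) (hφ : RingHom.ker φ = vanishingIdeal F Θ) :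
    ∃ θ ∈ Θ, (Module.finrank F (tangentSpace (vanishingIdeal F Θ) θ) : Cardinal) ≤
      Algebra.trdeg F A := by
  classical
  obtain ⟨s, hs, hp⟩ := exists_algebraicIndepOn_aeval_pderiv_ne_zero (R := F) fun i => φ (X i)
  have hφ_aeval : aeval (fun i => φ (X i)) = φ := (aeval_unique φ).symm
  simp only [hφ_aeval] at hp
  choose! p hsupp hker hne using hp
  have hprod : ∏ j with j ∉ s, pderiv j (p j) ∉ vanishingIdeal F Θ := by
    rw [← hφ, RingHom.mem_ker, map_prod, ← ne_eq, Finset.prod_ne_zero_iff]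
    exact fun j hj => hne j (Finset.mem_filter.1 hj).2
  simp only [mem_vanishingIdeal_iff, not_forall] at hprod
  obtain ⟨θ, hθ, hprodθ⟩ := hprod
  rw [aeval_eq_eval, map_prod, ← ne_eq, Finset.prod_ne_zero_iff] at hprodθ
  refine ⟨θ, hθ, ?_⟩
  have hle : Module.finrank F (tangentSpace (vanishingIdeal F Θ) θ) ≤ Nat.card s :=
    finrank_tangentSpace_le_card (fun j hj => hφ ▸ hker j hj) hsupp fun j hj =>
      hprodθ j (Finset.mem_filter.2 ⟨Finset.mem_univ j, hj⟩)
  have hcard := hs.lift_cardinalMk_le_trdeg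
  rw [← Nat.cast_card, Cardinal.lift_natCast, Cardinal.nat_le_lift_iff] at hcard
  exact (Nat.cast_le.2 hle).trans hcard

end TangentSpace

section RegularFunctions

variable {σ F : Type*} [Field F] {Γ : Set (σ → F)}

/-- The polynomials without zeros on `Γ`: the denominators of the rational functions that are
defined everywhere on `Γ`. -/
def nonvanishing (Γ : Set (σ → F)) : Submonoid (MvPolynomial σ F) where
  carrier := {q | ∀ γ ∈ Γ, eval γ q ≠ 0}
  one_mem' γ _ := by rw [map_one]; exact one_ne_zero
  mul_mem' hp hq γ hγ := by rw [map_mul]; exact mul_ne_zero (hp γ hγ) (hq γ hγ)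

/-- The ring of rational functions defined everywhere on `Γ`, as formal fractions; they are
determined by their values only if no nonzero polynomial vanishes on `Γ`. -/
abbrev RegularFunctions (Γ : Set (σ → F)) : Type _ :=
  Localization (nonvanishing Γ)

/-- Evaluation of rational functions at a point of `Γ`. -/
noncomputable def RegularFunctions.evalAt {γ : σ → F} (hγ : γ ∈ Γ) :
    RegularFunctions Γ →ₐ[F] F :=
  IsLocalization.liftAlgHom (M := nonvanishing Γ) (f := aeval γ) fun q =>
    isUnit_iff_ne_zero.2 (q.2 γ hγ)

theorem RegularFunctions.evalAt_mk' {γ : σ → F} (hγ : γ ∈ Γ) (p : MvPolynomial σ F)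
    (q : nonvanishing Γ) :
    evalAt hγ (IsLocalization.mk' _ p q) = eval γ p / eval γ (q : MvPolynomial σ F) := by
  rw [evalAt, IsLocalization.liftAlgHom_apply, IsLocalization.lift_mk'_spec, mul_comm]
  exact (div_mul_cancel₀ _ (q.2 γ hγ)).symm

theorem RegularFunctions.eq_zero_of_evalAt_eq_zero (hΓ : vanishingIdeal F Γ = ⊥)
    {r : RegularFunctions Γ} (hr : ∀ γ (hγ : γ ∈ Γ), evalAt hγ r = 0) : r = 0 := by
  obtain ⟨p, q, rfl⟩ := IsLocalization.exists_mk'_eq (nonvanishing Γ) r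
  have hp : p ∈ vanishingIdeal F Γ := fun γ hγ =>
    (div_eq_zero_iff.1 ((evalAt_mk' hγ p q).symm.trans (hr γ hγ))).resolve_right (q.2 γ hγ)
  rw [hΓ, Ideal.mem_bot] at hp
  rw [hp, IsLocalization.mk'_zero]

theorem nonvanishing_le_nonZeroDivisors (hΓ : Γ.Nonempty) :
    nonvanishing Γ ≤ nonZeroDivisors (MvPolynomial σ F) :=
  le_nonZeroDivisors_of_noZeroDivisors fun h => h _ hΓ.some_mem (map_zero _)

theorem RegularFunctions.isDomain (hΓ : Γ.Nonempty) : IsDomain (RegularFunctions Γ) :=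
  IsLocalization.isDomain_localization (nonvanishing_le_nonZeroDivisors hΓ)

theorem RegularFunctions.trdeg_eq [Finite σ] (hΓ : Γ.Nonempty) :
    Algebra.trdeg F (RegularFunctions Γ) = Nat.card σ := by
  have := RegularFunctions.isDomain hΓ
  have : FaithfulSMul (MvPolynomial σ F) (RegularFunctions Γ) :=
    (faithfulSMul_iff_algebraMap_injective _ _).2
      (IsLocalization.injective _ (nonvanishing_le_nonZeroDivisors hΓ))
  have : Algebra.IsAlgebraic (MvPolynomial σ F) (RegularFunctions Γ) :=
    IsLocalization.isAlgebraic _ (nonvanishing Γ)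
  rw [← trdeg_add_eq F (MvPolynomial σ F), MvPolynomial.trdeg_of_isDomain,
    trdeg_eq_zero, add_zero, ← Nat.cast_card, Cardinal.lift_natCast]

theorem IsRationalMapOn.exists_ker_eq_vanishingIdeal_image {d k : ℕ}
    {f : (Fin d → ℝ) → (Fin k → ℝ)} {Γ : Set (Fin d → ℝ)} (hf : IsRationalMapOn f Γ)
    (hΓ : vanishingIdeal ℝ Γ = ⊥) :
    ∃ φ : MvPolynomial (Fin k) ℝ →ₐ[ℝ] RegularFunctions Γ,
      RingHom.ker φ = vanishingIdeal ℝ (f '' Γ) := by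
  obtain ⟨p, q, hpq⟩ := hf
  let φ : MvPolynomial (Fin k) ℝ →ₐ[ℝ] RegularFunctions Γ := aeval fun i =>
    IsLocalization.mk' _ (p i) (⟨q i, fun γ hγ => (hpq γ hγ i).1⟩ : nonvanishing Γ)
  have hφ : ∀ γ (hγ : γ ∈ Γ), (RegularFunctions.evalAt hγ).comp φ = aeval (f γ) := fun γ hγ =>
    algHom_ext fun i => by
      rw [AlgHom.comp_apply, aeval_X, RegularFunctions.evalAt_mk', aeval_X, (hpq γ hγ i).2]
  refine ⟨φ, ?_⟩
  ext G
  rw [RingHom.mem_ker, mem_vanishingIdeal_iff, Set.forall_mem_image]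
  refine ⟨fun h γ hγ => ?_, fun h => ?_⟩
  · rw [← hφ γ hγ, AlgHom.comp_apply, h, map_zero]
  · refine RegularFunctions.eq_zero_of_evalAt_eq_zero hΓ fun γ hγ => ?_
    rw [← AlgHom.comp_apply, hφ γ hγ, h hγ]

end RegularFunctions

section Calculus

variable {𝕜 : Type*} [NontriviallyNormedField 𝕜]

theorem vanishingIdeal_eq_bot_of_mem_nhds {σ : Type*} {U : Set (σ → 𝕜)} {a : σ → 𝕜}
    (hU : U ∈ 𝓝 a) : vanishingIdeal 𝕜 U = ⊥ := by
  refine (Submodule.eq_bot_iff _).2 fun p hp => ?_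
  rw [nhds_pi, Filter.mem_pi] at hU
  obtain ⟨I, -, t, ht, htU⟩ := hU
  refine funext_set t (fun i => infinite_of_mem_nhds (a i) (ht i)) fun x hx => ?_
  rw [map_zero]
  exact hp x (htU fun i _ => hx i (Set.mem_univ i))

variable {σ : Type*} [Fintype σ] {E : Type*} [NormedAddCommGroup E] [NormedSpace 𝕜 E]

theorem hasStrictFDerivAt_eval (p : MvPolynomial σ 𝕜) (a : σ → 𝕜) :
    HasStrictFDerivAt (fun x => eval x p)
      (∑ j, polyGradient p a j • (ContinuousLinearMap.proj j : (σ → 𝕜) →L[𝕜] 𝕜)) a := by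
  induction p using MvPolynomial.induction_on with
  | C c =>
    simp only [eval_C]
    exact (hasStrictFDerivAt_const (𝕜 := 𝕜) c a).congr_fderiv <| by
      ext v
      simp [polyGradient]
  | add p q hp hq =>
    simp only [map_add]
    exact (hp.fun_add hq).congr_fderiv <| by
      ext v
      simp [polyGradient_add, add_mul, Finset.sum_add_distrib]
  | mul_X p i hp =>
    classical
    have hX : ∀ j, polyGradient (X i) a j = if i = j then 1 else 0 := fun j => by
      rw [polyGradient, pderiv_X, Pi.single_apply]
      split_ifs <;> simp
    simp only [map_mul, eval_X]
    have hproj := (ContinuousLinearMap.proj i : (σ → 𝕜) →L[𝕜] 𝕜).hasStrictFDerivAt (x := a)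
    exact (hp.mul hproj).congr_fderiv <| by
      ext v
      simp [polyGradient_mul, hX, add_mul, Finset.sum_add_distrib, Finset.mul_sum, mul_assoc]

theorem range_fderiv_le_tangentSpace {f : E → σ → 𝕜} {f' : E →L[𝕜] σ → 𝕜} {a : E} {U : Set E}
    (hf : HasFDerivAt f f' a) (hU : U ∈ 𝓝 a) :
    f'.range ≤ tangentSpace (vanishingIdeal 𝕜 (f '' U)) (f a) := by
  rintro _ ⟨v, rfl⟩ p hp
  have hzero : HasFDerivAt (fun x => eval (f x) p) (0 : E →L[𝕜] 𝕜) a :=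
    (hasFDerivAt_const 0 a).congr_of_eventuallyEq <| by
      filter_upwards [hU] with x hx using hp (f x) (Set.mem_image_of_mem f hx)
  have hcomp := ((hasStrictFDerivAt_eval p (f a)).hasFDerivAt.comp a hf).unique hzero
  simpa [dotProduct] using DFunLike.congr_fun hcomp v

theorem hasStrictFDerivAt_polyJacobian {n l : ℕ} (g : Fin l → MvPolynomial (Fin n) ℝ)
    (a : Fin n → ℝ) :
    HasStrictFDerivAt (fun x i => eval x (g i))
      (LinearMap.toContinuousLinearMap (polyJacobian g a).mulVecLin) a := by
  refine hasStrictFDerivAt_pi'.2 fun i => ?_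
  convert! hasStrictFDerivAt_eval (g i) a using 1
  ext v
  simp [polyJacobian, polyGradient, Matrix.mulVec, dotProduct]

theorem IsRationalMapOn.hasStrictFDerivAt {d k : ℕ} {f : (Fin d → ℝ) → (Fin k → ℝ)}
    {Γ : Set (Fin d → ℝ)} (hf : IsRationalMapOn f Γ) {a : Fin d → ℝ} (ha : Γ ∈ 𝓝 a) :
    HasStrictFDerivAt f (fderiv ℝ f a) a := by
  obtain ⟨p, q, hpq⟩ := hf
  have hcoord : ∀ i, ∃ f' : (Fin d → ℝ) →L[ℝ] ℝ, HasStrictFDerivAt (fun x => f x i) f' a := by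
    refine fun i => ⟨_, ((hasStrictFDerivAt_eval (p i) a).mul
      ((hasStrictDerivAt_inv (hpq a (mem_of_mem_nhds ha) i).1).comp_hasStrictFDerivAt a
        (hasStrictFDerivAt_eval (q i) a))).congr_of_eventuallyEq ?_⟩
    filter_upwards [ha] with x hx
    rw [(hpq x hx i).2, div_eq_mul_inv]
    rfl
  choose f' hf' using hcoord
  have hstrict := hasStrictFDerivAt_pi.2 hf'
  rwa [← hstrict.hasFDerivAt.fderiv] at hstrict

variable [CompleteSpace 𝕜] {F G : Type*} [NormedAddCommGroup F] [NormedSpace 𝕜 F]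
  [NormedAddCommGroup G] [NormedSpace 𝕜 G]

theorem exists_mem_nhds_injOn_of_injective_fderiv [FiniteDimensional 𝕜 E] {f : E → F}
    {f' : E →L[𝕜] F} {a : E} (hf : HasStrictFDerivAt f f' a) (hinj : Function.Injective f') :
    ∃ U ∈ 𝓝 a, Set.InjOn f U := by
  obtain ⟨K, hK, hf'K⟩ := f'.injective_iff_antilipschitz.1 hinj
  obtain ⟨c, hc, hcK⟩ := exists_between (inv_pos.2 hK)
  obtain ⟨U, hU, happrox⟩ := hf.approximates_deriv_on_nhds (Or.inr hc)
  refine ⟨U, hU, ?_⟩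
  have hanti : AntilipschitzWith (K⁻¹ - c)⁻¹ (U.domRestrict f) := by
    convert! (hf'K.domRestrict U).add_lipschitzWith happrox.lipschitz_sub hcK
    simp [Set.domRestrict]
  exact Set.injOn_iff_injective.2 hanti.injective

/-- Near `f a`, a zero of `g` is determined by its projection to the range of `f'`, and the
projections of the values of `f` fill a neighborhood of the projection of `f a`. -/
theorem nhdsWithin_preimage_zero_le_map_nhds [CompleteSpace E] [FiniteDimensional 𝕜 F]
    {f : E → F} {f' : E →L[𝕜] F} {g : F → G} {g' : F →L[𝕜] G} {a : E}
    (hf : HasStrictFDerivAt f f' a) (hg : HasStrictFDerivAt g g' (f a))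
    (hker : g'.ker ≤ f'.range) (hgf : ∀ᶠ x in 𝓝 a, g (f x) = 0) :
    𝓝[g ⁻¹' {0}] (f a) ≤ map f (𝓝 a) := by
  have := FiniteDimensional.complete 𝕜 f'.range
  obtain ⟨P, hP⟩ := LinearMap.exists_leftInverse_of_injective f'.range.subtype
    f'.range.ker_subtype
  replace hP : ∀ y : f'.range, P y = y := LinearMap.congr_fun hP
  let π : F →L[𝕜] f'.range := LinearMap.toContinuousLinearMap P
  have hπf : HasStrictFDerivAt (fun x => π (f x)) (π.comp f') a := π.hasStrictFDerivAt.comp a hf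
  have hsurj : (π.comp f').range = ⊤ := LinearMap.range_eq_top.2 fun ⟨_, x, hx⟩ => by
    subst hx
    exact ⟨x, hP ⟨f' x, x, rfl⟩⟩
  have hπg_inj : Function.Injective (π.prod g') := by
    rw [injective_iff_map_eq_zero]
    intro y hy
    obtain ⟨hπy, hgy⟩ := Prod.mk.inj hy
    exact congrArg Subtype.val ((hP ⟨y, hker hgy⟩).symm.trans hπy)
  obtain ⟨W, hW, hinjOn⟩ :=
    exists_mem_nhds_injOn_of_injective_fderiv (π.hasStrictFDerivAt.prodMk hg) hπg_inj
  intro S hS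
  have hN : {x | f x ∈ S ∧ f x ∈ W ∧ g (f x) = 0} ∈ 𝓝 a :=
    inter_mem hS (inter_mem (hf.continuousAt.preimage_mem_nhds hW) hgf)
  have hπN := hπf.map_nhds_eq_of_surj hsurj ▸ image_mem_map hN
  filter_upwards [mem_nhdsWithin_of_mem_nhds hW, self_mem_nhdsWithin,
    mem_nhdsWithin_of_mem_nhds (π.continuous.continuousAt.preimage_mem_nhds hπN)]
    with y hyW hgy ⟨x, ⟨hxS, hxW, hgx⟩, hxy⟩
  have hfx : f x = y := hinjOn hxW hyW (Prod.ext hxy (hgx.trans hgy.symm))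
  exact hfx ▸ hxS

end Calculus

section Varieties

variable {n : ℕ} {Θ : Set (Fin n → ℝ)}

theorem isVariety_zariskiClosure (Θ : Set (Fin n → ℝ)) : IsVariety (zariskiClosure Θ) :=
  ⟨vanishingIdeal ℝ Θ, rfl⟩

theorem subset_zariskiClosure (Θ : Set (Fin n → ℝ)) : Θ ⊆ zariskiClosure Θ :=
  zeroLocus_vanishingIdeal_le Θ

theorem vanishingIdeal_zariskiClosure (Θ : Set (Fin n → ℝ)) :
    vanishingIdeal ℝ (zariskiClosure Θ) = vanishingIdeal ℝ Θ :=
  le_antisymm (vanishingIdeal_anti_mono (subset_zariskiClosure Θ))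
    (le_vanishingIdeal_zeroLocus _)

theorem mem_zariskiClosure_iff_of_span_eq {l : ℕ} {g : Fin l → MvPolynomial (Fin n) ℝ}
    (hg : Ideal.span (Set.range g) = vanishingIdeal ℝ Θ) {θ : Fin n → ℝ} :
    θ ∈ zariskiClosure Θ ↔ ∀ i, eval θ (g i) = 0 := by
  rw [zariskiClosure, ← hg, zeroLocus_span]
  exact Set.forall_mem_range

theorem exists_span_range_eq_vanishingIdeal (Θ : Set (Fin n → ℝ)) :
    ∃ (l : ℕ) (g : Fin l → MvPolynomial (Fin n) ℝ),
      Ideal.span (Set.range g) = vanishingIdeal ℝ Θ :=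
  Submodule.fg_iff_exists_fin_generating_family.1 (IsNoetherian.noetherian _)

theorem mem_relInterior_iff {θ : Fin n → ℝ} :
    θ ∈ relInterior Θ ↔ θ ∈ zariskiClosure Θ ∧ Θ ∈ 𝓝[zariskiClosure Θ] θ := by
  rw [mem_nhdsWithin]
  constructor
  · rintro ⟨_, ⟨hsub, O, hO, rfl⟩, hθO, hθ⟩
    exact ⟨hθ, O, hO, hθO, hsub⟩
  · rintro ⟨hθ, O, hO, hθO, hsub⟩
    exact ⟨_, ⟨hsub, O, hO, rfl⟩, hθO, hθ⟩

theorem mem_relInterior_image_of_tangentSpace_le_range {E : Type*} [NormedAddCommGroup E]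
    [NormedSpace ℝ E] [CompleteSpace E] {f : E → Fin n → ℝ} {f' : E →L[ℝ] Fin n → ℝ} {a : E}
    {U : Set E} (hf : HasStrictFDerivAt f f' a) (hU : U ∈ 𝓝 a)
    (hle : tangentSpace (vanishingIdeal ℝ (f '' U)) (f a) ≤ f'.range) :
    f a ∈ relInterior (f '' U) := by
  have hsub := subset_zariskiClosure (f '' U)
  have hfa : f a ∈ zariskiClosure (f '' U) := hsub (Set.mem_image_of_mem f (mem_of_mem_nhds hU))
  refine mem_relInterior_iff.2 ⟨hfa, ?_⟩
  obtain ⟨l, g, hg⟩ := exists_span_range_eq_vanishingIdeal (f '' U)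
  have hzero : zariskiClosure (f '' U) = (fun y i => eval y (g i)) ⁻¹' {0} := by
    ext y
    exact (mem_zariskiClosure_iff_of_span_eq hg).trans funext_iff.symm
  rw [← hg, tangentSpace_span_range ((mem_zariskiClosure_iff_of_span_eq hg).1 hfa)] at hle
  rw [hzero] at hsub ⊢
  refine nhdsWithin_preimage_zero_le_map_nhds hf (hasStrictFDerivAt_polyJacobian g (f a)) hle ?_
    (image_mem_map hU)
  filter_upwards [hU] with x hx using hsub (Set.mem_image_of_mem f hx)

theorem exists_eval_ne_zero_of_isVariety_ssubset {A V : Set (Fin n → ℝ)} (hA : IsVariety A)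
    (hAV : A ⊂ V) : ∃ p ∉ vanishingIdeal ℝ V, ∀ x ∈ A, eval x p = 0 := by
  obtain ⟨F, rfl⟩ := hA
  obtain ⟨x, hxV, hx⟩ := Set.exists_of_ssubset hAV
  simp only [Set.mem_ofPred_eq, not_forall] at hx
  obtain ⟨p, hp, hpx⟩ := hx
  exact ⟨p, fun hpV => hpx (hpV x hxV), fun y hy => hy p hp⟩

theorem isIrreducibleVariety_zariskiClosure (hΘ : (vanishingIdeal ℝ Θ).IsPrime) :
    IsIrreducibleVariety (zariskiClosure Θ) := by
  refine ⟨isVariety_zariskiClosure Θ, ?_⟩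
  rintro ⟨A, B, hA, hB, hAV, hBV, hV⟩
  obtain ⟨p, hp, hpA⟩ := exists_eval_ne_zero_of_isVariety_ssubset hA hAV
  obtain ⟨q, hq, hqB⟩ := exists_eval_ne_zero_of_isVariety_ssubset hB hBV
  rw [← vanishingIdeal_zariskiClosure] at hΘ
  refine (hΘ.mem_or_mem (x := p) (y := q) fun x hx => ?_).elim hp hq
  rw [map_mul]
  rcases hV.subset hx with hxA | hxB
  · exact mul_eq_zero_of_left (hpA x hxA) _
  · exact mul_eq_zero_of_right _ (hqB x hxB)

theorem isComponent_self {V : Set (Fin n → ℝ)} (hV : IsIrreducibleVariety V) :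
    IsComponent V V :=
  ⟨⟨hV, subset_rfl⟩, fun _ hW _ => hW.2⟩

theorem finrank_tangentSpace_le_of_not_isSingularPoint (hΘ : (vanishingIdeal ℝ Θ).IsPrime)
    {θ θ' : Fin n → ℝ} (hθ : θ ∈ Θ) (hns : ¬IsSingularPoint Θ θ) (hθ' : θ' ∈ Θ) :
    Module.finrank ℝ (tangentSpace (vanishingIdeal ℝ Θ) θ) ≤
      Module.finrank ℝ (tangentSpace (vanishingIdeal ℝ Θ) θ') := by
  obtain ⟨l, g, hg⟩ := exists_span_range_eq_vanishingIdeal Θ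
  have hrank : (polyJacobian g θ').rank ≤ (polyJacobian g θ).rank := by
    by_contra! hlt
    have hsing : IsSingularOfIrreducible (zariskiClosure Θ) θ :=
      ⟨subset_zariskiClosure Θ hθ, l, g, hg.trans (vanishingIdeal_zariskiClosure Θ).symm,
        θ', subset_zariskiClosure Θ hθ', hlt⟩
    exact hns ⟨hθ, Or.inl
      ⟨_, isComponent_self (isIrreducibleVariety_zariskiClosure hΘ), hsing⟩⟩
  have hsum : ∀ x ∈ Θ, (polyJacobian g x).rank +
      Module.finrank ℝ (tangentSpace (vanishingIdeal ℝ Θ) x) = n := fun x hx => hg ▸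
    rank_polyJacobian_add_finrank_tangentSpace
      ((mem_zariskiClosure_iff_of_span_eq hg).1 (subset_zariskiClosure Θ hx))
  have := hsum θ hθ
  have := hsum θ' hθ'
  omega

end Varieties

theorem IsRationalMapOn.finrank_tangentSpace_image_le {d k : ℕ}
    {f : (Fin d → ℝ) → (Fin k → ℝ)} {Γ : Set (Fin d → ℝ)} (hf : IsRationalMapOn f Γ)
    (hΓ : vanishingIdeal ℝ Γ = ⊥) {θ : Fin k → ℝ} (hθ : θ ∈ f '' Γ)
    (hns : ¬IsSingularPoint (f '' Γ) θ) :
    Module.finrank ℝ (tangentSpace (vanishingIdeal ℝ (f '' Γ)) θ) ≤ d := by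
  have hne : Γ.Nonempty := Set.Nonempty.of_image ⟨θ, hθ⟩
  have := RegularFunctions.isDomain hne
  obtain ⟨φ, hφ⟩ := hf.exists_ker_eq_vanishingIdeal_image hΓ
  obtain ⟨θ', hθ', hle⟩ := exists_finrank_tangentSpace_le_trdeg φ hφ
  rw [RegularFunctions.trdeg_eq hne, Nat.cast_le, Nat.card_fin] at hle
  exact (finrank_tangentSpace_le_of_not_isSingularPoint (hφ ▸ RingHom.ker_isPrime φ) hθ hns
    hθ').trans hle

end RealAlg

open RealAlg in
theorem lemma4p4_general {d k : ℕ} {Γ : Set (Fin d → ℝ)} {f : (Fin d → ℝ) → (Fin k → ℝ)}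
    (hf : IsRationalMapOn f Γ) {γ₀ : Fin d → ℝ} (hΓ : Γ ∈ 𝓝 γ₀)
    (hns : ¬IsSingularPoint (f '' Γ) (f γ₀)) (hJ : (jacobian f γ₀).rank = min k d) :
    f γ₀ ∈ relInterior (f '' Γ) := by
  have hf' := hf.hasStrictFDerivAt hΓ
  refine mem_relInterior_image_of_tangentSpace_le_range hf' hΓ ?_
  have hrank : Module.finrank ℝ (fderiv ℝ f γ₀).range = min k d := by
    rw [← hJ, jacobian, Matrix.rank, ← Matrix.toLin'_apply', Matrix.toLin'_toMatrix']
  have hle_k : Module.finrank ℝ (tangentSpace (vanishingIdeal ℝ (f '' Γ)) (f γ₀)) ≤ k :=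
    (Submodule.finrank_le _).trans_eq (Module.finrank_fin_fun ℝ)
  have hle_d : Module.finrank ℝ (tangentSpace (vanishingIdeal ℝ (f '' Γ)) (f γ₀)) ≤ d :=
    hf.finrank_tangentSpace_image_le (vanishingIdeal_eq_bot_of_mem_nhds hΓ)
      (Set.mem_image_of_mem f (mem_of_mem_nhds hΓ)) hns
  exact (Submodule.eq_of_le_of_finrank_le (range_fderiv_le_tangentSpace hf'.hasFDerivAt hΓ)
    ((le_min hle_k hle_d).trans_eq hrank.symm)).ge

theorem lemma4p4 {d k : ℕ} (Γ : Set (Fin d → ℝ)) (hΓ_open : IsOpen Γ)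
    (hΓ : RealAlg.IsSemialgebraic Γ)
    (f : (Fin d → ℝ) → (Fin k → ℝ)) (hf : RealAlg.IsRationalMapOn f Γ)
    (Θ₀ : Set (Fin k → ℝ)) (hΘ₀ : Θ₀ = f '' Γ)
    (γ₀ : Fin d → ℝ) (hγ₀ : γ₀ ∈ Γ)
    (θ₀ : Fin k → ℝ) (hθ₀ : θ₀ = f γ₀)
    (hns : ¬ RealAlg.IsSingularPoint Θ₀ θ₀)
    (hJ : (RealAlg.jacobian f γ₀).rank = min k d) :
    θ₀ ∈ RealAlg.relInterior Θ₀ := by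
  subst hΘ₀ hθ₀
  exact lemma4p4_general hf (hΓ_open.mem_nhds hγ₀) hns hJ
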